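/- Let $F$ be a finite field in which $-1$ is not a square, let $e : F \to S^1$ be a non-principal (i.e. not identically $1$) additive character, and let $S = \{(\xi, \xi\cdot\xi) : \xi \in F^2\} \subset F^3$ be the paraboloid, where $x\cdot\xi = \sum_i x_i\xi_i$. For $g : S \to \mathbb{C}$ put $$(g\,d\sigma)^\vee(x) = \frac{1}{|S|}\sum_{\xi\in S} g(\xi)\, e(x\cdot \xi) \qquad (x \in F^3),$$ and for $1 \le p, q \le \infty$ let $R^*_S(p\to q)$ be the best constant such that $$\|(g\,d\sigma)^\vee\|_{L^q(F^3,dx)} \le R^*_S(p\to q)\, \|g\|_{L^p(S,d\sigma)} \quad\text{for all } g : S \to \mathbb{C},$$ where $dx$ is counting measure on $F^3$ and $d\sigma$ is the probability measure on $S$ giving mass $1/|S|$ to each point. **Theorem.** For every $\varepsilon>0$ there is a finite constant $C_\varepsilon$, depending only on $\varepsilon$ (not on $F$ or $e$), such that for all such $F$ and $e$ $$R^*_S\left(2 \to \tfrac{18}{5}+\varepsilon\right) \le C_\varepsilon .$$ -/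

import Mathlib

open MeasureTheory
open scoped NNReal ENNReal Matrix

noncomputable section

/-- The paraboloid `{(ξ, ξ · ξ) : ξ ∈ F ^ d}` in `F ^ (d + 1)`. -/
def paraboloid (F : Type*) [Field F] [Fintype F] (d : ℕ) : Finset (Fin (d + 1) → F) :=
  open Classical in
  Finset.univ.image fun ξ : Fin d → F => Fin.snoc (α := fun _ => F) ξ (ξ ⬝ᵥ ξ)

/-- Counting measure `dx` on `F ^ n` (every set is measurable). -/
def countingMeasure (F : Type*) (n : ℕ) : @Measure (Fin n → F) ⊤ :=
  @Measure.count (Fin n → F) ⊤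

/-- Normalized surface measure `dσ` on `S`: it gives the mass `1 / |S|` to each point of `S`
(every subset of `S` is measurable). -/
def surfaceMeasure {F : Type*} {n : ℕ} (S : Finset (Fin n → F)) : @Measure S ⊤ :=
  (S.card : ℝ≥0∞)⁻¹ • @Measure.count S ⊤

/-- The inverse Fourier transform `(g dσ)ˇ (x) = (1 / |S|) ∑_{ξ ∈ S} g(ξ) e(x · ξ)` of the measure
`g dσ`, with respect to the additive character `e`. -/
def extension {F : Type*} [Field F] [Fintype F] {n : ℕ} (e : AddChar F Circle)
    (S : Finset (Fin n → F)) (g : S → ℂ) (x : Fin n → F) : ℂ :=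
  (S.card : ℂ)⁻¹ * ∑ ξ : S, g ξ * (e (x ⬝ᵥ (ξ : Fin n → F)) : ℂ)

/-- The best constant `R*_S(p → q)` in the extension inequality
`‖(g dσ)ˇ‖_{L^q(F^n, dx)} ≤ R*_S(p → q) ‖g‖_{L^p(S, dσ)}` for all `g : S → ℂ`. It is taken
in `[0, ∞]`, so that it would be `∞` if no finite constant worked. -/
def restrictionConst {F : Type*} [Field F] [Fintype F] {n : ℕ} (e : AddChar F Circle)
    (S : Finset (Fin n → F)) (p q : ℝ≥0∞) : ℝ≥0∞ :=
  sInf {R : ℝ≥0∞ | ∀ g : S → ℂ,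
    eLpNorm (extension e S g) q (countingMeasure F n) ≤ R * eLpNorm g p (surfaceMeasure S)}

end

/-! The estimate is proved in dual form by a `T T*` argument at the endpoint 18/5 in weak type, and
ε pays for the passage to strong type. For a set `E` of frequencies and coefficients of modulus at
most 1, the squared `L²` norm on the paraboloid splits by height difference (`dual_sum_le`). Pairs
at equal height contribute at most |F|²|E|. The remaining part M has two bounds. The kernel has
modulus |F| there, so M ≤ |F||E|² (`offDiagonalSum_le`), which is good for small `E`. For large `E`,
completing the square turns convolution of a horizontal slice with the kernel into an extension of
that slice (`sliceConvolution_eq`). Its `L⁴` norm counts rectangles in the slice, hence right-angled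
corners (`sum_norm_pow_four_le`). As -1 is not a square, no nonzero plane vector is isotropic, so n
points have O(n^(5/2)) corners by a Cauchy–Schwarz incidence argument (`cornerCount_sq_le`). Summing
over slices gives M⁸ ≲ |F|¹⁷|E|¹¹ (`offDiagonalSum_pow_eight_le`). Multiplying the two bounds gives
M⁹ ≲ |F|¹⁸|E|¹³. By duality this is the weak-type bound with exponent 18/5 (`extension_weak_type`),
uniform in F. -/

/-- The standard bilinear form on the plane. -/
def planeDot {F : Type*} [Field F] (x y : F × F) : F := x.1 * y.1 + x.2 * y.2

/-! ### Right-angled corners in a plane without isotropic vectors. -/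

section Incidence

variable {F : Type*} [Field F]

theorem planeDot_self_eq_zero (hF : ¬ IsSquare (-1 : F)) {v : F × F} (h : planeDot v v = 0) :
    v = 0 := by
  obtain ⟨a, b⟩ := v
  simp only [planeDot] at h
  by_cases hb : b = 0
  · subst hb
    simp at h
    simp [h]
  · refine absurd ⟨a / b, ?_⟩ hF
    field_simp
    linear_combination -h

/-- For a fixed `d`, the lines through `a` perpendicular to `d - a` are pairwise distinct, so two
of them meet in at most one point. -/
theorem perpendicular_lines_inter (hF : ¬ IsSquare (-1 : F)) {a a' c c' d : F × F}
    (ha : a ≠ d) (ha' : a' ≠ d) (haa : a ≠ a')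
    (h₁ : planeDot (a - c) (a - d) = 0) (h₂ : planeDot (a' - c) (a' - d) = 0)
    (h₃ : planeDot (a - c') (a - d) = 0) (h₄ : planeDot (a' - c') (a' - d) = 0) : c = c' := by
  by_contra hcc
  have hv : planeDot (c - c') (c - c') ≠ 0 := fun h =>
    hcc (sub_eq_zero.1 (planeDot_self_eq_zero hF h))
  -- Subtracting the two equations shows that b - d is orthogonal to c - c', so it is a multiple s
  -- of c - c' rotated by a right angle.
  have hs : ∀ b : F × F, planeDot (b - c) (b - d) = 0 → planeDot (b - c') (b - d) = 0 →
      ∃ s : F, b.1 - d.1 = s * (c.2 - c'.2) ∧ b.2 - d.2 = - s * (c.1 - c'.1) := by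
    intro b h h'
    simp only [planeDot, Prod.fst_sub, Prod.snd_sub] at h h' hv
    refine ⟨((b.1 - d.1) * (c.2 - c'.2) - (b.2 - d.2) * (c.1 - c'.1)) /
      ((c.1 - c'.1) * (c.1 - c'.1) + (c.2 - c'.2) * (c.2 - c'.2)), ?_, ?_⟩
    · rw [div_mul_eq_mul_div, eq_div_iff hv]
      linear_combination (c.1 - c'.1) * (h' - h)
    · rw [← neg_div, div_mul_eq_mul_div, eq_div_iff hv]
      linear_combination (c.2 - c'.2) * (h' - h)
  obtain ⟨s, hs₁, hs₂⟩ := hs a h₁ h₃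
  obtain ⟨r, hr₁, hr₂⟩ := hs a' h₂ h₄
  -- Substituting b in terms of s leaves s times a linear polynomial in s. Since b ≠ d the factor s
  -- cancels, and the leading coefficient is nonzero by anisotropy, so s, and with it b, is unique.
  have key : ∀ (b : F × F) (s : F), b ≠ d → b.1 - d.1 = s * (c.2 - c'.2) →
      b.2 - d.2 = - s * (c.1 - c'.1) → planeDot (b - c) (b - d) = 0 →
      s * planeDot (c - c') (c - c') + (d.1 - c.1) * (c.2 - c'.2) -
        (d.2 - c.2) * (c.1 - c'.1) = 0 := by
    intro b s hb h h' h''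
    have hs0 : s ≠ 0 := by
      rintro rfl
      apply hb
      ext
      · linear_combination h
      · linear_combination h'
    apply mul_left_cancel₀ hs0
    simp only [planeDot, Prod.fst_sub, Prod.snd_sub] at h'' ⊢
    have e₁ : b.1 = d.1 + s * (c.2 - c'.2) := by linear_combination h
    have e₂ : b.2 = d.2 - s * (c.1 - c'.1) := by linear_combination h'
    rw [e₁, e₂] at h''
    linear_combination h''
  have k₁ := key a s ha hs₁ hs₂ h₁
  have k₂ := key a' r ha' hr₁ hr₂ h₂
  have hsr : s = r := by
    apply mul_right_cancel₀ hv
    linear_combination k₁ - k₂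
  subst hsr
  apply haa
  ext
  · linear_combination hs₁ - hr₁
  · linear_combination hs₂ - hr₂

open Classical in
/-- The number of right-angled corners `(a, c, d)` with vertices in `E` and the right angle
at `a`. -/
noncomputable def cornerCount (E : Finset (F × F)) : ℕ :=
  ∑ d ∈ E, ∑ c ∈ E, (E.filter fun a => planeDot (a - c) (a - d) = 0).card

-- Point-line incidences: Cauchy–Schwarz over c reduces the count to pairs of distinct lines, and
-- each such pair shares at most one point c. The point a = d is erased because it defines no line.
open Classical in
theorem corner_incidence_sq_le (hF : ¬ IsSquare (-1 : F)) (E : Finset (F × F)) (d : F × F) :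
    (∑ c ∈ E, ((E.erase d).filter fun a => planeDot (a - c) (a - d) = 0).card) ^ 2 ≤
      4 * E.card ^ 3 := by
  set L := fun c => (E.erase d).filter fun a => planeDot (a - c) (a - d) = 0 with hL
  set N := ∑ c ∈ E, (L c).card with hN
  have h₁ : N ^ 2 ≤ E.card * ∑ c ∈ E, (L c).card ^ 2 := sq_sum_le_card_mul_sum_sq
  have h₂ : ∑ c ∈ E, (L c).card ^ 2 ≤ N + E.card ^ 2 := by
    have h₃ : ∀ c ∈ E, (L c).card ^ 2 = (L c).card + (L c).offDiag.card := by
      intro c _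
      rw [Finset.offDiag_card, sq]
      have := Nat.le_mul_self (L c).card
      omega
    rw [Finset.sum_congr rfl h₃, Finset.sum_add_distrib, ← hN]
    gcongr
    have h₄ : ∑ c ∈ E, (L c).offDiag.card =
        ∑ p ∈ E.offDiag, (E.filter fun c => p ∈ (L c).offDiag).card := by
      have := Finset.sum_card_bipartiteAbove_eq_sum_card_bipartiteBelow (s := E) (t := E.offDiag)
        (fun c p => p ∈ (L c).offDiag)
      rw [← Finset.sum_congr rfl fun _ _ => rfl] at this
      simp only [Finset.bipartiteAbove, Finset.bipartiteBelow] at this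
      rw [← this]
      refine Finset.sum_congr rfl fun c _ => congrArg _ ?_
      ext p
      simp only [Finset.mem_filter, Finset.mem_offDiag, hL, Finset.mem_erase]
      tauto
    rw [h₄]
    calc _ ≤ ∑ p ∈ E.offDiag, 1 := by
          refine Finset.sum_le_sum fun p _ => Finset.card_le_one.2 ?_
          intro c hc c' hc'
          simp only [Finset.mem_filter, Finset.mem_offDiag, hL, Finset.mem_erase] at hc hc'
          obtain ⟨-, ⟨⟨h1, -⟩, h2⟩, ⟨⟨h3, -⟩, h4⟩, h5⟩ := hc
          obtain ⟨-, ⟨-, h6⟩, ⟨-, h7⟩, -⟩ := hc'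
          exact perpendicular_lines_inter hF h1 h3 h5 h2 h4 h6 h7
      _ ≤ E.card ^ 2 := by
          rw [Finset.sum_const, smul_eq_mul, mul_one, Finset.offDiag_card, sq]
          exact Nat.sub_le _ _
  have h₃ : N ^ 2 ≤ E.card * (N + E.card ^ 2) := h₁.trans (Nat.mul_le_mul_left _ h₂)
  by_contra! hcon
  rcases Nat.eq_zero_or_pos E.card with h0 | h0
  · rw [h0] at h₃ hcon
    simp at h₃
    simp [h₃] at hcon
  -- If N ≤ 2|E| the claim is immediate. Otherwise the term |E|N in `h₃` is less than N²/2 and is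
  -- absorbed into the left side.
  · have h₄ : 2 * E.card < N := by
      by_contra! h
      have : N ^ 2 ≤ (2 * E.card) ^ 2 := Nat.pow_le_pow_left h 2
      nlinarith [Nat.pow_le_pow_right h0 (show 2 ≤ 3 by norm_num)]
    nlinarith

open Classical in
theorem cornerCount_sq_le (hF : ¬ IsSquare (-1 : F)) (E : Finset (F × F)) :
    cornerCount E ^ 2 ≤ 10 * E.card ^ 5 := by
  have h₁ : cornerCount E ^ 2 ≤ E.card * ∑ d ∈ E,
      (∑ c ∈ E, (E.filter fun a => planeDot (a - c) (a - d) = 0).card) ^ 2 :=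
    sq_sum_le_card_mul_sum_sq
  have h₂ : ∀ d ∈ E, (∑ c ∈ E, (E.filter fun a => planeDot (a - c) (a - d) = 0).card) ^ 2 ≤
      10 * E.card ^ 3 := by
    intro d hd
    -- Restoring the degenerate a = d costs at most 1 for each c. The constant 10 is then 2 · (4 +
    -- 1).
    have h₃ : ∑ c ∈ E, (E.filter fun a => planeDot (a - c) (a - d) = 0).card ≤
        (∑ c ∈ E, ((E.erase d).filter fun a => planeDot (a - c) (a - d) = 0).card) + E.card := by
      rw [Finset.card_eq_sum_ones E, ← Finset.sum_add_distrib]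
      refine Finset.sum_le_sum fun c _ => ?_
      rw [Finset.filter_erase]
      exact Nat.sub_le_iff_le_add.1 Finset.pred_card_le_card_erase
    have h₄ := corner_incidence_sq_le hF E d
    have h₅ : 0 < E.card := Finset.card_pos.2 ⟨d, hd⟩
    have h₆ := Nat.pow_le_pow_right h₅ (show 2 ≤ 3 by norm_num)
    generalize (∑ c ∈ E, ((E.erase d).filter fun a => planeDot (a - c) (a - d) = 0).card) = N at *
    calc _ ≤ (N + E.card) ^ 2 := Nat.pow_le_pow_left h₃ 2
      _ ≤ 2 * (N ^ 2 + E.card ^ 2) := add_sq_le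
      _ ≤ _ := by omega
  calc _ ≤ E.card * ∑ d ∈ E, 10 * E.card ^ 3 := h₁.trans (Nat.mul_le_mul_left _
        (Finset.sum_le_sum h₂))
    _ = _ := by rw [Finset.sum_const, smul_eq_mul]; ring

theorem two_ne_zero_of_not_isSquare_neg_one (hF : ¬ IsSquare (-1 : F)) : (2 : F) ≠ 0 := by
  intro h
  exact hF ⟨1, by linear_combination -h⟩

end Incidence

/-! ### Character sums, the `L⁴` norm and the Gauss-sum kernel. -/

section Characters

variable {F : Type*} [Field F]

/-- The pairing of the frequency `z = (x, t)` with the point `(ξ, ξ · ξ)` of the paraboloid. -/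
def paraboloidPhase (z : (F × F) × F) (ξ : F × F) : F := planeDot z.1 ξ + z.2 * planeDot ξ ξ

variable [Fintype F]

/-- This single expansion serves the `L⁴` count, the modulus of the Gauss sum (with Z a point) and
the `T T*` identity. -/
theorem sum_norm_sq_char_expand {ι Z : Type*} [Fintype Z] (ψ : AddChar F ℂ) (I : Finset ι)
    (c : ι → ℂ) (θ : ι → Z → F) :
    ((∑ z, ‖∑ i ∈ I, c i * ψ (θ i z)‖ ^ 2 : ℝ) : ℂ) =
      ∑ i ∈ I, ∑ j ∈ I, c i * starRingEnd ℂ (c j) * ∑ z, ψ (θ i z - θ j z) := by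
  push_cast
  have h : ∀ z, ((‖∑ i ∈ I, c i * ψ (θ i z)‖ : ℂ)) ^ 2 =
      ∑ i ∈ I, ∑ j ∈ I, c i * starRingEnd ℂ (c j) * ψ (θ i z - θ j z) := by
    intro z
    rw [← Complex.mul_conj', map_sum, Finset.sum_mul_sum]
    refine Finset.sum_congr rfl fun i _ => Finset.sum_congr rfl fun j _ => ?_
    rw [sub_eq_add_neg, AddChar.map_add_eq_mul, AddChar.map_neg_eq_conj, map_mul]
    ring
  rw [Finset.sum_congr rfl fun z _ => h z, Finset.sum_comm]
  refine Finset.sum_congr rfl fun i _ => ?_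
  rw [Finset.sum_comm]
  exact Finset.sum_congr rfl fun j _ => (Finset.mul_sum _ _ _).symm

open Classical in
theorem sum_char_mul {ψ : AddChar F ℂ} (hψ : ψ ≠ 1) (c : F) :
    ∑ x, ψ (x * c) = if c = 0 then (Fintype.card F : ℂ) else 0 := by
  rw [AddChar.sum_mulShift c (AddChar.IsPrimitive.of_ne_one hψ)]
  split_ifs <;> simp

open Classical in
theorem norm_sum_char_space {ψ : AddChar F ℂ} (hψ : ψ ≠ 1) (u v w : F) :
    ‖∑ z : (F × F) × F, ψ (z.1.1 * u + z.1.2 * v + z.2 * w)‖ =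
      if u = 0 ∧ v = 0 ∧ w = 0 then (Fintype.card F : ℝ) ^ 3 else 0 := by
  have h : ∑ z : (F × F) × F, ψ (z.1.1 * u + z.1.2 * v + z.2 * w) =
      ((∑ x, ψ (x * u)) * ∑ x, ψ (x * v)) * ∑ x, ψ (x * w) := by
    simp only [AddChar.map_add_eq_mul, Fintype.sum_prod_type, ← Finset.mul_sum, ← Finset.sum_mul]
  rw [h, sum_char_mul hψ, sum_char_mul hψ, sum_char_mul hψ]
  split_ifs <;> simp_all
  ring

open Classical in
theorem sum_norm_sq_char_le {ι : Type*} {ψ : AddChar F ℂ} (hψ : ψ ≠ 1) (I : Finset ι)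
    (c : ι → ℂ) (hc : ∀ i, ‖c i‖ ≤ 1) (v : ι → (F × F) × F) :
    ∑ z : (F × F) × F,
        ‖∑ i ∈ I, c i * ψ (z.1.1 * (v i).1.1 + z.1.2 * (v i).1.2 + z.2 * (v i).2)‖ ^ 2 ≤
      (Fintype.card F : ℝ) ^ 3 * ((I ×ˢ I).filter fun p => v p.1 = v p.2).card := by
  have h := sum_norm_sq_char_expand ψ I c
    (fun i (z : (F × F) × F) => z.1.1 * (v i).1.1 + z.1.2 * (v i).1.2 + z.2 * (v i).2)
  have h0 : 0 ≤ ∑ z : (F × F) × F,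
      ‖∑ i ∈ I, c i * ψ (z.1.1 * (v i).1.1 + z.1.2 * (v i).1.2 + z.2 * (v i).2)‖ ^ 2 := by
    positivity
  rw [← Real.norm_of_nonneg h0, ← Complex.norm_real, h, Finset.card_filter, Nat.cast_sum,
    Finset.mul_sum, Finset.sum_product]
  refine (norm_sum_le _ _).trans (Finset.sum_le_sum fun i _ => (norm_sum_le _ _).trans
    (Finset.sum_le_sum fun j _ => ?_))
  have e : ∀ z : (F × F) × F, z.1.1 * (v i).1.1 + z.1.2 * (v i).1.2 + z.2 * (v i).2 -
      (z.1.1 * (v j).1.1 + z.1.2 * (v j).1.2 + z.2 * (v j).2) =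
      z.1.1 * ((v i).1.1 - (v j).1.1) + z.1.2 * ((v i).1.2 - (v j).1.2) +
        z.2 * ((v i).2 - (v j).2) := fun z => by ring
  simp only [e]
  rw [norm_mul, norm_sum_char_space hψ, norm_mul, RCLike.norm_conj]
  have e' : ((v i).1.1 - (v j).1.1 = 0 ∧ (v i).1.2 - (v j).1.2 = 0 ∧ (v i).2 - (v j).2 = 0) ↔
      v i = v j := by
    simp only [sub_eq_zero, Prod.ext_iff, and_assoc]
  simp only [e']
  split_ifs
  · have : ‖c i‖ * ‖c j‖ ≤ 1 := mul_le_one₀ (hc i) (norm_nonneg _) (hc j)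
    push_cast
    nlinarith [show (0 : ℝ) ≤ (Fintype.card F : ℝ) ^ 3 by positivity]
  · simp

open Classical in
/-- The `L⁴` norm of an extension is controlled by the number of right-angled corners. -/
theorem sum_norm_pow_four_le (hF : ¬ IsSquare (-1 : F)) {ψ : AddChar F ℂ} (hψ : ψ ≠ 1)
    (E : Finset (F × F)) (g : F × F → ℂ) (hg : ∀ y, ‖g y‖ ≤ 1) :
    ∑ z : (F × F) × F, ‖∑ y ∈ E, g y * ψ (paraboloidPhase z y)‖ ^ 4 ≤
      (Fintype.card F : ℝ) ^ 3 * cornerCount E := by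
  have h₁ : ∀ z : (F × F) × F, ‖∑ y ∈ E, g y * ψ (paraboloidPhase z y)‖ ^ 4 =
      ‖∑ p ∈ E ×ˢ E, (g p.1 * g p.2) * ψ (z.1.1 * (p.1.1 + p.2.1) + z.1.2 * (p.1.2 + p.2.2) +
        z.2 * (planeDot p.1 p.1 + planeDot p.2 p.2))‖ ^ 2 := by
    intro z
    rw [show (4 : ℕ) = 2 * 2 by norm_num, pow_mul, ← norm_pow, sq (∑ y ∈ E, _),
      Finset.sum_mul_sum, Finset.sum_product]
    congr 2
    refine Finset.sum_congr rfl fun a _ => Finset.sum_congr rfl fun b _ => ?_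
    rw [show z.1.1 * (a.1 + b.1) + z.1.2 * (a.2 + b.2) + z.2 * (planeDot a a + planeDot b b) =
      paraboloidPhase z a + paraboloidPhase z b by simp only [paraboloidPhase, planeDot]; ring,
      AddChar.map_add_eq_mul]
    ring
  simp only [h₁]
  refine (sum_norm_sq_char_le hψ (E ×ˢ E) (fun p => g p.1 * g p.2) (fun p => by
    rw [norm_mul]; exact mul_le_one₀ (hg _) (norm_nonneg _) (hg _))
    (fun p => ((p.1.1 + p.2.1, p.1.2 + p.2.2), planeDot p.1 p.1 + planeDot p.2 p.2))).trans ?_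
  gcongr
  have h₂ : cornerCount E =
      ((E ×ˢ E ×ˢ E).filter fun p => planeDot (p.2.2 - p.2.1) (p.2.2 - p.1) = 0).card := by
    simp only [cornerCount, Finset.card_filter, Finset.sum_product]
  rw [h₂]
  -- In a + b = c + d the point b is determined by the others. Eliminating it from the equation |a|²
  -- + |b|² = |c|² + |d|² leaves 2 (a - c)·(a - d) = 0, a right angle at a.
  refine Finset.card_le_card_of_injOn (fun r => (r.2.2, r.2.1, r.1.1)) ?_ ?_
  · rintro ⟨⟨a, b⟩, c, d⟩ h
    simp only [Finset.coe_filter, Finset.mem_product, Set.mem_ofPred_eq, Prod.mk.injEq,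
      planeDot] at h
    obtain ⟨⟨⟨ha, hb⟩, hc, hd⟩, ⟨h1, h2⟩, h3⟩ := h
    simp only [Finset.coe_filter, Finset.mem_product, Set.mem_ofPred_eq]
    refine ⟨⟨hd, hc, ha⟩, ?_⟩
    apply mul_left_cancel₀ (two_ne_zero_of_not_isSquare_neg_one hF)
    simp only [planeDot, Prod.fst_sub, Prod.snd_sub]
    have e1 : b.1 = c.1 + d.1 - a.1 := by linear_combination h1
    have e2 : b.2 = c.2 + d.2 - a.2 := by linear_combination h2
    rw [e1, e2] at h3
    linear_combination h3
  · rintro ⟨⟨a, b⟩, c, d⟩ h ⟨⟨a', b'⟩, c', d'⟩ h' he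
    simp only [Finset.coe_filter, Finset.mem_product, Set.mem_ofPred_eq, Prod.mk.injEq] at h h' he
    obtain ⟨rfl, rfl, rfl⟩ := he
    obtain ⟨-, ⟨h1, h2⟩, -⟩ := h
    obtain ⟨-, ⟨h1', h2'⟩, -⟩ := h'
    have : b = b' := by
      ext
      · linear_combination h1 - h1'
      · linear_combination h2 - h2'
    rw [this]

theorem norm_sum_char_sq {ψ : AddChar F ℂ} (hψ : ψ ≠ 1) (h2 : (2 : F) ≠ 0) {t : F} (ht : t ≠ 0) :
    ‖∑ s : F, ψ (t * s ^ 2)‖ ^ 2 = Fintype.card F := by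
  classical
  have h := sum_norm_sq_char_expand (Z := Unit) ψ Finset.univ (fun _ => 1)
    (fun (s : F) _ => t * s ^ 2)
  simp only [one_mul, Finset.univ_unique, Finset.sum_singleton, map_one] at h
  have h' : ∑ i : F, ∑ j : F, ψ (t * i ^ 2 - t * j ^ 2) = (Fintype.card F : ℂ) := by
    -- The shift makes the phase linear in j, so summing over j leaves only i = 0.
    have e : ∀ i j : F, t * (j + i) ^ 2 - t * j ^ 2 = t * i ^ 2 + j * (2 * t * i) := by
      intro i j; ring
    rw [Finset.sum_comm]
    have e' : ∀ j : F, ∑ i : F, ψ (t * i ^ 2 - t * j ^ 2) =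
        ∑ i : F, ψ (t * (j + i) ^ 2 - t * j ^ 2) := fun j =>
      (Equiv.sum_comp (Equiv.addLeft j) fun i => ψ (t * i ^ 2 - t * j ^ 2)).symm
    simp only [e', e, AddChar.map_add_eq_mul]
    rw [Finset.sum_comm]
    simp only [← Finset.mul_sum, sum_char_mul hψ, mul_eq_zero, h2, ht, false_or]
    simp
  rw [h'] at h
  exact_mod_cast h

/-- The Fourier transform of the (unnormalised) surface measure of the paraboloid. -/
noncomputable def paraboloidKernel (ψ : AddChar F ℂ) (z : (F × F) × F) : ℂ :=
  ∑ ξ : F × F, ψ (paraboloidPhase z ξ)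

open Classical in
theorem paraboloidKernel_zero {ψ : AddChar F ℂ} (hψ : ψ ≠ 1) (x : F × F) :
    paraboloidKernel ψ (x, 0) = if x = 0 then (Fintype.card F : ℂ) ^ 2 else 0 := by
  have h : paraboloidKernel ψ (x, 0) = (∑ s, ψ (s * x.1)) * ∑ s, ψ (s * x.2) := by
    simp only [paraboloidKernel, paraboloidPhase, planeDot, zero_mul, add_zero,
      AddChar.map_add_eq_mul, Fintype.sum_prod_type, Finset.sum_mul_sum]
    refine Finset.sum_congr rfl fun i _ => Finset.sum_congr rfl fun j _ => ?_
    rw [mul_comm x.1, mul_comm x.2]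
  rw [h, sum_char_mul hψ, sum_char_mul hψ]
  simp only [Prod.ext_iff, Prod.fst_zero, Prod.snd_zero]
  split_ifs <;> simp_all
  ring

/-- The sum factors over the two coordinates, and completing the square in each yields one Gauss
sum. The explicit phase, not just the modulus, is needed for the pseudo-conformal identity. -/
theorem paraboloidKernel_of_ne (h2 : (2 : F) ≠ 0) (ψ : AddChar F ℂ) (x : F × F) {t : F}
    (ht : t ≠ 0) :
    paraboloidKernel ψ (x, t) =
      (∑ s : F, ψ (t * s ^ 2)) ^ 2 * ψ (-(planeDot x x / (4 * t))) := by
  have h4 : (4 : F) ≠ 0 := by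
    rw [show (4 : F) = 2 * 2 by norm_num]; exact mul_ne_zero h2 h2
  have e : ∀ y : F, ∑ s : F, ψ (y * s + t * s ^ 2) =
      ψ (-(y ^ 2 / (4 * t))) * ∑ s : F, ψ (t * s ^ 2) := by
    intro y
    rw [← Equiv.sum_comp (Equiv.addLeft (y / (2 * t))) fun s => ψ (t * s ^ 2), Finset.mul_sum]
    refine Finset.sum_congr rfl fun s _ => ?_
    rw [← AddChar.map_add_eq_mul]
    congr 1
    simp only [Equiv.coe_addLeft]
    field_simp
    ring
  have h : paraboloidKernel ψ (x, t) =
      (∑ s : F, ψ (x.1 * s + t * s ^ 2)) * ∑ s : F, ψ (x.2 * s + t * s ^ 2) := by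
    simp only [paraboloidKernel, Fintype.sum_prod_type, Finset.sum_mul_sum,
      ← AddChar.map_add_eq_mul]
    refine Finset.sum_congr rfl fun i _ => Finset.sum_congr rfl fun j _ => ?_
    congr 1
    simp only [paraboloidPhase, planeDot]
    ring
  rw [h, e, e, planeDot, show -((x.1 * x.1 + x.2 * x.2) / (4 * t)) =
    -(x.1 ^ 2 / (4 * t)) + -(x.2 ^ 2 / (4 * t)) by ring, AddChar.map_add_eq_mul]
  ring

theorem norm_paraboloidKernel_of_ne {ψ : AddChar F ℂ} (hψ : ψ ≠ 1) (h2 : (2 : F) ≠ 0)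
    (x : F × F) {t : F} (ht : t ≠ 0) : ‖paraboloidKernel ψ (x, t)‖ = Fintype.card F := by
  rw [paraboloidKernel_of_ne h2 ψ x ht, norm_mul, norm_pow, norm_sum_char_sq hψ h2 ht,
    AddChar.norm_apply, mul_one]

end Characters

/-! ### Summation over horizontal slices. -/

/-- Hölder with exponent 8/5, chosen so that the bounds on the terms become linear in n and the
slice sizes add up to |E|. -/
theorem sum_pow_eight_le {ι : Type*} (s : Finset ι) {m n : ι → ℝ} {c : ℝ}
    (hm : ∀ i ∈ s, 0 ≤ m i) (hn : ∀ i ∈ s, 0 ≤ n i) (hc : 0 ≤ c)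
    (h : ∀ i ∈ s, m i ^ 8 ≤ c * n i ^ 5) :
    (∑ i ∈ s, m i) ^ 8 ≤ c * s.card ^ 3 * (∑ i ∈ s, n i) ^ 5 := by
  have h₁ := Real.rpow_sum_le_const_mul_sum_rpow s m (p := 8 / 5) (by norm_num)
  rw [Finset.sum_congr rfl fun i hi => abs_of_nonneg (hm i hi)] at h₁
  have h₂ : ∀ i ∈ s, |m i| ^ (8 / 5 : ℝ) ≤ c ^ (1 / 5 : ℝ) * n i := by
    intro i hi
    rw [abs_of_nonneg (hm i hi), show (8 / 5 : ℝ) = (8 : ℕ) * (1 / 5) by norm_num,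
      Real.rpow_mul (hm i hi), Real.rpow_natCast]
    calc (m i ^ 8) ^ (1 / 5 : ℝ) ≤ (c * n i ^ 5) ^ (1 / 5 : ℝ) :=
          Real.rpow_le_rpow (pow_nonneg (hm i hi) _) (h i hi) (by norm_num)
      _ = c ^ (1 / 5 : ℝ) * n i := by
          rw [Real.mul_rpow hc (pow_nonneg (hn i hi) _), ← Real.rpow_natCast (n i) 5,
            ← Real.rpow_mul (hn i hi)]
          norm_num
  have hS : 0 ≤ ∑ i ∈ s, m i := Finset.sum_nonneg hm
  have h₃ : (∑ i ∈ s, m i) ^ (8 / 5 : ℝ) ≤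
      (s.card : ℝ) ^ (3 / 5 : ℝ) * (c ^ (1 / 5 : ℝ) * ∑ i ∈ s, n i) := by
    refine h₁.trans ?_
    rw [Finset.mul_sum s n, show (8 / 5 - 1 : ℝ) = 3 / 5 by norm_num]
    gcongr with i hi
    exact h₂ i hi
  have h₄ := pow_le_pow_left₀ (Real.rpow_nonneg hS _) h₃ 5
  rw [mul_pow, mul_pow, ← Real.rpow_mul_natCast hS, ← Real.rpow_mul_natCast (Nat.cast_nonneg _),
    ← Real.rpow_mul_natCast hc] at h₄
  norm_num at h₄
  calc _ ≤ _ := h₄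
    _ = _ := by ring

section Slices

variable {F : Type*} [Fintype F]

open Classical in
/-- The horizontal slice of `E` at height `s`. -/
noncomputable def horizontalSlice (E : Finset ((F × F) × F)) (s : F) : Finset (F × F) :=
  Finset.univ.filter fun y => (y, s) ∈ E

theorem sum_horizontalSlice {A : Type*} [AddCommMonoid A] (E : Finset ((F × F) × F))
    (φ : (F × F) × F → A) :
    ∑ s, ∑ y ∈ horizontalSlice E s, φ (y, s) = ∑ x ∈ E, φ x := by
  classical
  simp only [horizontalSlice, Finset.sum_filter]
  rw [Finset.sum_comm, ← Fintype.sum_prod_type fun x : (F × F) × F => if x ∈ E then φ x else 0,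
    ← Finset.sum_filter]
  simp

theorem sum_card_horizontalSlice (E : Finset ((F × F) × F)) :
    ∑ s, (horizontalSlice E s).card = E.card := by
  simpa only [Finset.card_eq_sum_ones] using sum_horizontalSlice E fun _ => 1

end Slices

/-! ### The dual quadratic form and its off-diagonal part. -/

section Dual

variable {F : Type*} [Field F]

/-- The pseudo-conformal change of variables which turns convolution of a slice with the Fourier
transform of the surface measure into an extension operator. -/
def pseudoConformal (s : F) (x : (F × F) × F) : (F × F) × F :=
  ((x.1.1 / (2 * (x.2 - s)), x.1.2 / (2 * (x.2 - s))), -(1 / (4 * (x.2 - s))))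

theorem pseudoConformal_injOn (h2 : (2 : F) ≠ 0) (s : F) :
    Set.InjOn (pseudoConformal s) {x | x.2 ≠ s} := by
  have h4 : (4 : F) ≠ 0 := by
    rw [show (4 : F) = 2 * 2 by norm_num]; exact mul_ne_zero h2 h2
  rintro ⟨⟨a, b⟩, t⟩ hx ⟨⟨a', b'⟩, t'⟩ hx' h
  have ht : t - s ≠ 0 := sub_ne_zero.2 hx
  have ht' : t' - s ≠ 0 := sub_ne_zero.2 hx'
  simp only [pseudoConformal, Prod.mk.injEq] at h
  obtain ⟨⟨h1, h2'⟩, h3⟩ := h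
  have e : t = t' := by
    field_simp at h3
    linear_combination h3
  subst e
  field_simp at h1 h2'
  rw [h1, h2']

variable [Fintype F]

/-- The size at `x` of the convolution of the slice of `g` at height `s` with the Fourier
transform of the surface measure. -/
noncomputable def sliceConvolution (ψ : AddChar F ℂ) (E : Finset ((F × F) × F))
    (g : (F × F) × F → ℂ) (s : F) (x : (F × F) × F) : ℝ :=
  ‖∑ y ∈ horizontalSlice E s, g (y, s) * paraboloidKernel ψ (x - (y, s))‖

/-- With u = x.2 - s, expand (x.1 - y)·(x.1 - y)/(4u) in the kernel's phase. The term in x alone has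
modulus one and drops out, while the cross term and the term in y form the paraboloid phase at the
transformed point. -/
theorem sliceConvolution_eq {ψ : AddChar F ℂ} (hψ : ψ ≠ 1) (h2 : (2 : F) ≠ 0)
    (E : Finset ((F × F) × F)) (g : (F × F) × F → ℂ) {s : F} {x : (F × F) × F} (hx : x.2 ≠ s) :
    sliceConvolution ψ E g s x = Fintype.card F *
      ‖∑ y ∈ horizontalSlice E s,
        g (y, s) * ψ (paraboloidPhase (pseudoConformal s x) y)‖ := by
  have hu : x.2 - s ≠ 0 := sub_ne_zero.2 hx
  have h4 : (4 : F) ≠ 0 := by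
    rw [show (4 : F) = 2 * 2 by norm_num]; exact mul_ne_zero h2 h2
  have h : ∀ y : F × F, paraboloidKernel ψ (x - (y, s)) =
      ((∑ r : F, ψ ((x.2 - s) * r ^ 2)) ^ 2 * ψ (-(planeDot x.1 x.1 / (4 * (x.2 - s))))) *
        ψ (paraboloidPhase (pseudoConformal s x) y) := by
    intro y
    rw [show x - (y, s) = (x.1 - y, x.2 - s) from rfl, paraboloidKernel_of_ne h2 ψ _ hu, mul_assoc,
      ← AddChar.map_add_eq_mul]
    congr 2
    simp only [planeDot, paraboloidPhase, pseudoConformal, Prod.fst_sub, Prod.snd_sub]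
    field_simp
    ring
  have h' : ‖((∑ r : F, ψ ((x.2 - s) * r ^ 2)) ^ 2 *
      ψ (-(planeDot x.1 x.1 / (4 * (x.2 - s)))))‖ = Fintype.card F := by
    rw [norm_mul, norm_pow, norm_sum_char_sq hψ h2 hu, AddChar.norm_apply, mul_one]
  rw [sliceConvolution, ← h', ← norm_mul, Finset.mul_sum]
  congr 1
  refine Finset.sum_congr rfl fun y _ => ?_
  rw [h y]
  ring

-- Injectivity of the change of variables bounds the sum over `E` by the full `L⁴` norm. The
-- exponent 7 is 4 from the size of the kernel plus 3 from orthogonality on the frequency space.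
open Classical in
theorem sum_sliceConvolution_pow_four_le (hF : ¬ IsSquare (-1 : F)) {ψ : AddChar F ℂ}
    (hψ : ψ ≠ 1) (E : Finset ((F × F) × F)) {g : (F × F) × F → ℂ} (hg : ∀ x, ‖g x‖ ≤ 1) (s : F) :
    ∑ x ∈ E.filter (fun x => x.2 ≠ s), sliceConvolution ψ E g s x ^ 4 ≤
      (Fintype.card F : ℝ) ^ 7 * cornerCount (horizontalSlice E s) := by
  have h2 := two_ne_zero_of_not_isSquare_neg_one hF
  set A : (F × F) × F → ℝ := fun z => ‖∑ y ∈ horizontalSlice E s,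
        g (y, s) * ψ (paraboloidPhase z y)‖ ^ 4 with hA
  calc _ = (Fintype.card F : ℝ) ^ 4 *
        ∑ x ∈ E.filter (fun x => x.2 ≠ s), A (pseudoConformal s x) := by
        rw [Finset.mul_sum]
        refine Finset.sum_congr rfl fun x hx => ?_
        rw [sliceConvolution_eq hψ h2 E g (Finset.mem_filter.1 hx).2, mul_pow]
    _ ≤ (Fintype.card F : ℝ) ^ 4 * ∑ z, A z := by
        gcongr
        rw [← Finset.sum_image (f := A) (g := pseudoConformal s)]
        · exact Finset.sum_le_sum_of_subset_of_nonneg (Finset.subset_univ _)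
            fun z _ _ => by positivity
        · refine (pseudoConformal_injOn h2 s).mono fun x hx => ?_
          simpa using (Finset.mem_filter.1 hx).2
    _ ≤ (Fintype.card F : ℝ) ^ 4 *
          ((Fintype.card F : ℝ) ^ 3 * cornerCount (horizontalSlice E s)) := by
        gcongr
        exact sum_norm_pow_four_le hF hψ _ (fun y => g (y, s)) fun y => hg _
    _ = _ := by ring

open Classical in
/-- The contribution to the dual quadratic form of pairs of points at different heights. -/
noncomputable def offDiagonalSum (ψ : AddChar F ℂ) (E : Finset ((F × F) × F))
    (g : (F × F) × F → ℂ) : ℝ :=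
  ∑ s, ∑ x ∈ E.filter (fun x => x.2 ≠ s), sliceConvolution ψ E g s x

theorem offDiagonalSum_nonneg (ψ : AddChar F ℂ) (E : Finset ((F × F) × F))
    (g : (F × F) × F → ℂ) : 0 ≤ offDiagonalSum ψ E g :=
  Finset.sum_nonneg fun _ _ => Finset.sum_nonneg fun _ _ => norm_nonneg _

theorem offDiagonalSum_le {ψ : AddChar F ℂ} (hψ : ψ ≠ 1) (h2 : (2 : F) ≠ 0)
    (E : Finset ((F × F) × F)) {g : (F × F) × F → ℂ} (hg : ∀ x, ‖g x‖ ≤ 1) :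
    offDiagonalSum ψ E g ≤ Fintype.card F * (E.card : ℝ) ^ 2 := by
  classical
  have h : ∀ s, ∑ x ∈ E.filter (fun x => x.2 ≠ s), sliceConvolution ψ E g s x ≤
      E.card * ((horizontalSlice E s).card * Fintype.card F : ℝ) := by
    intro s
    calc _ ≤ ∑ x ∈ E.filter (fun x => x.2 ≠ s),
          ((horizontalSlice E s).card * Fintype.card F : ℝ) := by
          refine Finset.sum_le_sum fun x hx => ?_
          rw [← nsmul_eq_mul, ← Finset.sum_const]
          refine (norm_sum_le _ _).trans (Finset.sum_le_sum fun y _ => ?_)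
          rw [norm_mul, show x - (y, s) = (x.1 - y, x.2 - s) from rfl,
            norm_paraboloidKernel_of_ne hψ h2 _ (sub_ne_zero.2 (Finset.mem_filter.1 hx).2)]
          exact mul_le_of_le_one_left (Nat.cast_nonneg _) (hg _)
      _ ≤ _ := by
          rw [Finset.sum_const, nsmul_eq_mul]
          gcongr
          exact Finset.filter_subset _ _
  refine (Finset.sum_le_sum fun s _ => h s).trans_eq ?_
  rw [← Finset.mul_sum, ← Finset.sum_mul, ← Nat.cast_sum, sum_card_horizontalSlice]
  ring

/-- The fourth power comes from Hölder on `E` against the `L⁴` bound, and squaring brings in the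
corner bound. Hölder over the |F| heights then adds |F|³ and turns the slice sizes into |E|⁵. -/
theorem offDiagonalSum_pow_eight_le (hF : ¬ IsSquare (-1 : F)) {ψ : AddChar F ℂ} (hψ : ψ ≠ 1)
    (E : Finset ((F × F) × F)) {g : (F × F) × F → ℂ} (hg : ∀ x, ‖g x‖ ≤ 1) :
    offDiagonalSum ψ E g ^ 8 ≤ 10 * (Fintype.card F : ℝ) ^ 17 * (E.card : ℝ) ^ 11 := by
  classical
  have h : ∀ s ∈ (Finset.univ : Finset F),
      (∑ x ∈ E.filter (fun x => x.2 ≠ s), sliceConvolution ψ E g s x) ^ 8 ≤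
        (10 * (Fintype.card F : ℝ) ^ 14 * (E.card : ℝ) ^ 6) *
          ((horizontalSlice E s).card : ℝ) ^ 5 := by
    intro s _
    have h0 : 0 ≤ ∑ x ∈ E.filter (fun x => x.2 ≠ s), sliceConvolution ψ E g s x :=
      Finset.sum_nonneg fun _ _ => norm_nonneg _
    have h₁ : (∑ x ∈ E.filter (fun x => x.2 ≠ s), sliceConvolution ψ E g s x) ^ 4 ≤
        (E.card : ℝ) ^ 3 *
          ((Fintype.card F : ℝ) ^ 7 * cornerCount (horizontalSlice E s)) := by
      have hk : ((E.filter (fun x => x.2 ≠ s)).card : ℝ) ≤ E.card := by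
        exact_mod_cast Finset.card_filter_le _ _
      have h₂ := sq_sum_le_card_mul_sum_sq (s := E.filter (fun x => x.2 ≠ s))
        (f := sliceConvolution ψ E g s)
      have h₃ := sq_sum_le_card_mul_sum_sq (s := E.filter (fun x => x.2 ≠ s))
        (f := fun x => sliceConvolution ψ E g s x ^ 2)
      simp only [← pow_mul] at h₃
      have h₄ := sum_sliceConvolution_pow_four_le hF hψ E hg s
      have h₅ : 0 ≤ ∑ x ∈ E.filter (fun x => x.2 ≠ s), sliceConvolution ψ E g s x ^ 4 := by
        positivity
      calc _ = ((∑ x ∈ E.filter (fun x => x.2 ≠ s), sliceConvolution ψ E g s x) ^ 2) ^ 2 := by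
            ring
        _ ≤ _ := pow_le_pow_left₀ (by positivity) h₂ 2
        _ = _ := mul_pow _ _ 2
        _ ≤ _ := mul_le_mul_of_nonneg_left h₃ (by positivity)
        _ = ((E.filter (fun x => x.2 ≠ s)).card : ℝ) ^ 3 *
              ∑ x ∈ E.filter (fun x => x.2 ≠ s), sliceConvolution ψ E g s x ^ 4 := by ring
        _ ≤ _ := by gcongr
    have h₂ : (cornerCount (horizontalSlice E s) : ℝ) ^ 2 ≤
        10 * ((horizontalSlice E s).card : ℝ) ^ 5 := by
      exact_mod_cast cornerCount_sq_le hF (horizontalSlice E s)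
    calc _ = ((∑ x ∈ E.filter (fun x => x.2 ≠ s), sliceConvolution ψ E g s x) ^ 4) ^ 2 := by ring
      _ ≤ _ := pow_le_pow_left₀ (by positivity) h₁ 2
      _ = (Fintype.card F : ℝ) ^ 14 * (E.card : ℝ) ^ 6 *
            (cornerCount (horizontalSlice E s) : ℝ) ^ 2 := by ring
      _ ≤ (Fintype.card F : ℝ) ^ 14 * (E.card : ℝ) ^ 6 *
            (10 * ((horizontalSlice E s).card : ℝ) ^ 5) := by gcongr
      _ = _ := by ring
  have h' := sum_pow_eight_le Finset.univ
    (fun s _ => Finset.sum_nonneg fun _ _ => norm_nonneg _)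
    (fun s _ => Nat.cast_nonneg _) (by positivity) h
  rw [← Nat.cast_sum, sum_card_horizontalSlice, Finset.card_univ] at h'
  calc _ ≤ _ := h'
    _ = _ := by ring

theorem sliceConvolution_self_le {ψ : AddChar F ℂ} (hψ : ψ ≠ 1)
    (E : Finset ((F × F) × F)) {g : (F × F) × F → ℂ} (hg : ∀ x, ‖g x‖ ≤ 1) (x : (F × F) × F) :
    sliceConvolution ψ E g x.2 x ≤ (Fintype.card F : ℝ) ^ 2 := by
  classical
  refine (norm_sum_le _ _).trans ?_
  have h : ∀ y ∈ horizontalSlice E x.2, ‖g (y, x.2) * paraboloidKernel ψ (x - (y, x.2))‖ ≤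
      if x.1 = y then (Fintype.card F : ℝ) ^ 2 else 0 := by
    intro y _
    rw [norm_mul, show x - (y, x.2) = (x.1 - y, x.2 - x.2) from rfl, sub_self,
      paraboloidKernel_zero hψ]
    simp only [sub_eq_zero]
    split_ifs
    · simpa using mul_le_of_le_one_left (by positivity) (hg _)
    · simp
  refine (Finset.sum_le_sum h).trans ?_
  rw [Finset.sum_ite_eq]
  split_ifs
  · exact le_rfl
  · positivity

/-- Expanding the square pairs points of `E` through the kernel of their difference. At equal
heights the kernel vanishes unless the points coincide, which leaves |F|² per point. -/
theorem dual_sum_le {ψ : AddChar F ℂ} (hψ : ψ ≠ 1) (E : Finset ((F × F) × F))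
    {f : (F × F) × F → ℂ} (hf : ∀ x, ‖f x‖ ≤ 1) :
    ∑ ξ : F × F, ‖∑ x ∈ E, f x * ψ (paraboloidPhase x ξ)‖ ^ 2 ≤
      (Fintype.card F : ℝ) ^ 2 * E.card + offDiagonalSum ψ E fun x => starRingEnd ℂ (f x) := by
  classical
  set g : (F × F) × F → ℂ := fun x => starRingEnd ℂ (f x) with hg'
  have hg : ∀ x, ‖g x‖ ≤ 1 := fun x => by rw [hg', RCLike.norm_conj]; exact hf x
  have h := sum_norm_sq_char_expand ψ E f fun x ξ => paraboloidPhase x ξ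
  have h0 : 0 ≤ ∑ ξ : F × F, ‖∑ x ∈ E, f x * ψ (paraboloidPhase x ξ)‖ ^ 2 := by positivity
  have e : ∀ x y : (F × F) × F, ∀ ξ : F × F, paraboloidPhase x ξ - paraboloidPhase y ξ =
      paraboloidPhase (x - y) ξ := by
    intro x y ξ
    simp only [paraboloidPhase, planeDot, Prod.fst_sub, Prod.snd_sub]
    ring
  have h₁ : ∀ x, ∑ y ∈ E, f x * starRingEnd ℂ (f y) *
      ∑ ξ, ψ (paraboloidPhase x ξ - paraboloidPhase y ξ) =
      f x * ∑ s, ∑ y ∈ horizontalSlice E s, g (y, s) * paraboloidKernel ψ (x - (y, s)) := by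
    intro x
    rw [sum_horizontalSlice E fun y => g y * paraboloidKernel ψ (x - y), Finset.mul_sum]
    refine Finset.sum_congr rfl fun y _ => ?_
    simp only [e, paraboloidKernel, hg', mul_assoc]
  rw [← Real.norm_of_nonneg h0, ← Complex.norm_real, h, Finset.sum_congr rfl fun x _ => h₁ x]
  have h₂ : ∀ x, ‖f x * ∑ s, ∑ y ∈ horizontalSlice E s,
      g (y, s) * paraboloidKernel ψ (x - (y, s))‖ ≤
      (Fintype.card F : ℝ) ^ 2 + ∑ s, if x.2 ≠ s then sliceConvolution ψ E g s x else 0 := by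
    intro x
    rw [norm_mul]
    refine (mul_le_of_le_one_left (norm_nonneg _) (hf x)).trans ((norm_sum_le _ _).trans ?_)
    rw [← Finset.add_sum_erase _ _ (Finset.mem_univ x.2), ← Finset.sum_filter]
    refine add_le_add (sliceConvolution_self_le hψ E hg x) (le_of_eq ?_)
    refine Finset.sum_congr ?_ fun s _ => rfl
    ext s
    simp [eq_comm]
  refine (norm_sum_le _ _).trans ((Finset.sum_le_sum fun x _ => h₂ x).trans_eq ?_)
  rw [Finset.sum_add_distrib, Finset.sum_const, nsmul_eq_mul, Finset.sum_comm, mul_comm]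
  simp only [offDiagonalSum, Finset.sum_filter]

theorem dual_sum_pow_nine_le (hF : ¬ IsSquare (-1 : F)) {ψ : AddChar F ℂ} (hψ : ψ ≠ 1)
    (E : Finset ((F × F) × F)) {f : (F × F) × F → ℂ} (hf : ∀ x, ‖f x‖ ≤ 1) :
    (∑ ξ : F × F, ‖∑ x ∈ E, f x * ψ (paraboloidPhase x ξ)‖ ^ 2) ^ 9 ≤
      2816 * (Fintype.card F : ℝ) ^ 18 * (E.card : ℝ) ^ 13 := by
  have h := dual_sum_le hψ E hf
  have hg : ∀ x, ‖starRingEnd ℂ (f x)‖ ≤ 1 := fun x => by rw [RCLike.norm_conj]; exact hf x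
  have h₁ := offDiagonalSum_le hψ (two_ne_zero_of_not_isSquare_neg_one hF) E hg
  have h₂ := offDiagonalSum_pow_eight_le hF hψ E hg
  have h₃ := offDiagonalSum_nonneg ψ E fun x => starRingEnd ℂ (f x)
  set M := offDiagonalSum ψ E fun x => starRingEnd ℂ (f x)
  -- Eight factors of M use the `L⁴` bound and one uses the trivial bound. The power |F|¹⁸ matches
  -- that of the diagonal term, and the final constant is 2⁸ · (1 + 10) = 2816.
  have h₄ : M ^ 9 ≤ 10 * (Fintype.card F : ℝ) ^ 18 * (E.card : ℝ) ^ 13 := by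
    calc M ^ 9 = M ^ 8 * M := by ring
      _ ≤ (10 * (Fintype.card F : ℝ) ^ 17 * (E.card : ℝ) ^ 11) *
          (Fintype.card F * (E.card : ℝ) ^ 2) := by gcongr
      _ = _ := by ring
  have h₅ : (E.card : ℝ) ^ 9 ≤ (E.card : ℝ) ^ 13 := by
    rcases Nat.eq_zero_or_pos E.card with h0 | h0
    · simp [h0]
    · exact_mod_cast Nat.pow_le_pow_right h0 (by norm_num)
  calc _ ≤ ((Fintype.card F : ℝ) ^ 2 * E.card + M) ^ 9 :=
        pow_le_pow_left₀ (by positivity) h 9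
    _ ≤ 2 ^ (9 - 1) * (((Fintype.card F : ℝ) ^ 2 * E.card) ^ 9 + M ^ 9) :=
        add_pow_le (by positivity) h₃ 9
    _ ≤ 2 ^ (9 - 1) * ((Fintype.card F : ℝ) ^ 18 * (E.card : ℝ) ^ 13 +
          10 * (Fintype.card F : ℝ) ^ 18 * (E.card : ℝ) ^ 13) := by
        rw [mul_pow, ← pow_mul]
        gcongr
    _ = _ := by ring

end Dual

/-! ### Duality, and from weak type to strong type. -/

/-- A weak-type bound implies strong-type bounds for all larger exponents. -/
theorem sum_rpow_le_of_weak_type {X : Type*} {h : X → ℝ} (hh : ∀ x, 0 ≤ h x) {M : ℝ}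
    (H : ∀ (s : Finset X) (a : ℝ), 0 ≤ a → (∀ x ∈ s, a ≤ h x) → a ^ 18 * (s.card : ℝ) ^ 5 ≤ M)
    {q : ℝ} (hq : 0 < q) (s : Finset X) :
    ∑ x ∈ s, h x ^ q ≤
      M ^ (q / 18) * ∑ k ∈ Finset.range s.card, ((k + 1 : ℕ) : ℝ) ^ (-(5 * q / 18)) := by
  classical
  -- Adding points in decreasing order of h makes each new value the minimum of the set so far. The
  -- hypothesis applied at that level bounds the k-th largest value by (M / k⁵)^(1/18).
  induction s using Finset.induction_on_min_value h with
  | empty => simp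
  | insert a s ha hmin ih =>
    rw [Finset.sum_insert ha, Finset.card_insert_of_notMem ha, Finset.sum_range_succ, mul_add,
      add_comm]
    refine add_le_add ih ?_
    have h₁ := H (insert a s) (h a) (hh a) (by
      intro x hx
      rcases Finset.mem_insert.1 hx with rfl | hx
      · exact le_rfl
      · exact hmin x hx)
    rw [Finset.card_insert_of_notMem ha] at h₁
    have hc : (0 : ℝ) < ((s.card + 1 : ℕ) : ℝ) := by positivity
    have h₂ : h a ^ 18 ≤ M * ((s.card + 1 : ℕ) : ℝ) ^ (-5 : ℝ) := by
      rw [Real.rpow_neg hc.le, ← div_eq_mul_inv, le_div_iff₀ (by positivity)]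
      exact_mod_cast h₁
    have hM : 0 ≤ M := le_trans (by have := hh a; positivity) h₁
    calc h a ^ q = (h a ^ 18) ^ (q / 18) := by
          rw [← Real.rpow_natCast, ← Real.rpow_mul (hh a)]
          congr 1
          push_cast
          ring
      _ ≤ (M * ((s.card + 1 : ℕ) : ℝ) ^ (-5 : ℝ)) ^ (q / 18) :=
          Real.rpow_le_rpow (pow_nonneg (hh a) _) h₂ (by positivity)
      _ = _ := by
          rw [Real.mul_rpow hM (by positivity), ← Real.rpow_mul hc.le]
          congr 2
          ring

/-- The zeta sum that controls the passage from weak type to strong type. -/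
noncomputable def weakTypeConst (q : ℝ) : ℝ := ∑' k : ℕ, ((k + 1 : ℕ) : ℝ) ^ (-(5 * q / 18))

/-- Convergence needs 5q/18 > 1, which is where the endpoint 18/5 is lost. -/
theorem sum_range_le_weakTypeConst {q : ℝ} (hq : 18 / 5 < q) (n : ℕ) :
    ∑ k ∈ Finset.range n, ((k + 1 : ℕ) : ℝ) ^ (-(5 * q / 18)) ≤ weakTypeConst q :=
  ((summable_nat_add_iff 1).2 (Real.summable_nat_rpow.2 (by linarith))).sum_le_tsum _
    fun _ _ => by positivity

theorem exists_norm_le_one_mul_eq_norm (w : ℂ) : ∃ u : ℂ, ‖u‖ ≤ 1 ∧ u * w = ‖w‖ := by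
  by_cases hw : w = 0
  · exact ⟨0, by simp, by simp [hw]⟩
  · have hn : (‖w‖ : ℂ) ≠ 0 := by simpa using hw
    refine ⟨starRingEnd ℂ w / ‖w‖, ?_, ?_⟩
    · rw [norm_div, RCLike.norm_conj, Complex.norm_real, norm_norm]
      exact div_self_le_one _
    · rw [div_mul_eq_mul_div, Complex.conj_mul', sq, mul_div_assoc, div_self hn, mul_one]

section WeakType

variable {F : Type*} [Field F] [Fintype F]

/-- Choosing unimodular phases on `E`, exchanging the sums and applying Cauchy–Schwarz gives (t|E|)²
≤ A·B with B the dual quadratic form. Its ninth power carries |E|¹³ against |E|¹⁸, leaving |E|⁵. -/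
theorem extension_weak_type (hF : ¬ IsSquare (-1 : F)) {ψ : AddChar F ℂ} (hψ : ψ ≠ 1)
    (a : F × F → ℂ) (E : Finset ((F × F) × F)) {t : ℝ} (ht : 0 ≤ t)
    (hE : ∀ x ∈ E, t ≤ ‖∑ ξ : F × F, a ξ * ψ (paraboloidPhase x ξ)‖) :
    t ^ 18 * (E.card : ℝ) ^ 5 ≤
      2816 * (Fintype.card F : ℝ) ^ 18 * (∑ ξ, ‖a ξ‖ ^ 2) ^ 9 := by
  choose f hf hf' using fun x : (F × F) × F =>
    exists_norm_le_one_mul_eq_norm (∑ ξ : F × F, a ξ * ψ (paraboloidPhase x ξ))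
  set B := ∑ ξ : F × F, ‖∑ x ∈ E, f x * ψ (paraboloidPhase x ξ)‖ ^ 2 with hB
  set A := ∑ ξ, ‖a ξ‖ ^ 2 with hA
  have hA0 : 0 ≤ A := by positivity
  have h₁ : t * E.card ≤ ∑ ξ : F × F, ‖a ξ‖ * ‖∑ x ∈ E, f x * ψ (paraboloidPhase x ξ)‖ := by
    calc t * E.card = ∑ x ∈ E, t := by rw [Finset.sum_const, nsmul_eq_mul, mul_comm]
      _ ≤ ∑ x ∈ E, ‖∑ ξ : F × F, a ξ * ψ (paraboloidPhase x ξ)‖ := Finset.sum_le_sum hE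
      _ = ‖∑ x ∈ E, f x * ∑ ξ : F × F, a ξ * ψ (paraboloidPhase x ξ)‖ := by
          rw [Finset.sum_congr rfl fun x _ => hf' x, ← Complex.ofReal_sum, Complex.norm_real,
            Real.norm_of_nonneg (Finset.sum_nonneg fun _ _ => norm_nonneg _)]
      _ = ‖∑ ξ : F × F, a ξ * ∑ x ∈ E, f x * ψ (paraboloidPhase x ξ)‖ := by
          simp only [Finset.mul_sum]
          rw [Finset.sum_comm]
          simp only [mul_left_comm]
      _ ≤ _ := (norm_sum_le _ _).trans_eq (by simp only [norm_mul])
  have h₂ : (t * E.card) ^ 2 ≤ A * B :=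
    (pow_le_pow_left₀ (by positivity) h₁ 2).trans (Finset.sum_mul_sq_le_sq_mul_sq _ _ _)
  have h₃ := dual_sum_pow_nine_le hF hψ E hf
  have h₄ : (t * E.card) ^ 18 ≤
      A ^ 9 * (2816 * (Fintype.card F : ℝ) ^ 18 * (E.card : ℝ) ^ 13) := by
    calc _ = ((t * E.card) ^ 2) ^ 9 := by ring
      _ ≤ (A * B) ^ 9 := pow_le_pow_left₀ (by positivity) h₂ 9
      _ = A ^ 9 * B ^ 9 := mul_pow _ _ _
      _ ≤ _ := mul_le_mul_of_nonneg_left h₃ (by positivity)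
  rcases Nat.eq_zero_or_pos E.card with h0 | h0
  · rw [h0]
    simp only [Nat.cast_zero, ne_eq, OfNat.ofNat_ne_zero, not_false_eq_true, zero_pow, mul_zero]
    positivity
  · have h0' : (0 : ℝ) < (E.card : ℝ) ^ 13 := by positivity
    refine le_of_mul_le_mul_right ?_ h0'
    calc _ = (t * E.card) ^ 18 := by ring
      _ ≤ _ := h₄
      _ = _ := by ring

theorem sum_extension_rpow_le (hF : ¬ IsSquare (-1 : F)) {ψ : AddChar F ℂ} (hψ : ψ ≠ 1)
    (a : F × F → ℂ) {q : ℝ} (hq : 18 / 5 < q) :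
    (∑ x : (F × F) × F, ((Fintype.card F : ℝ) ^ 2)⁻¹ ^ q *
        ‖∑ ξ : F × F, a ξ * ψ (paraboloidPhase x ξ)‖ ^ q) ^ (1 / q) ≤
      (2816 ^ (1 / 18 : ℝ) * weakTypeConst q ^ (1 / q)) *
        (((Fintype.card F : ℝ) ^ 2)⁻¹ * ∑ ξ, ‖a ξ‖ ^ 2) ^ (1 / 2 : ℝ) := by
  have hq0 : 0 < q := by linarith
  have hQ : (0 : ℝ) < Fintype.card F := by exact_mod_cast Fintype.card_pos
  set A := ((Fintype.card F : ℝ) ^ 2)⁻¹ * ∑ ξ, ‖a ξ‖ ^ 2 with hA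
  have hA0 : 0 ≤ A := by positivity
  have hZ : 0 ≤ weakTypeConst q := tsum_nonneg fun _ => by positivity
  set h : (F × F) × F → ℝ := fun x => ((Fintype.card F : ℝ) ^ 2)⁻¹ *
    ‖∑ ξ : F × F, a ξ * ψ (paraboloidPhase x ξ)‖ with hh
  have h₁ := sum_rpow_le_of_weak_type (h := h) (M := 2816 * A ^ 9) (fun x => by positivity)
    (fun s t ht hs => by
      have := extension_weak_type hF hψ a s (t := (Fintype.card F : ℝ) ^ 2 * t) (by positivity)
        (fun x hx => (le_inv_mul_iff₀ (by positivity)).1 (hs x hx))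
      -- The normalisations put |F|³⁶ on both sides: (|F|²)¹⁸ on the left, |F|¹⁸ · (|F|²)⁹ on the
      -- right. Hence the constant does not depend on F.
      have h36 : (0 : ℝ) < (Fintype.card F : ℝ) ^ 36 := by positivity
      refine le_of_mul_le_mul_right ?_ h36
      calc _ = ((Fintype.card F : ℝ) ^ 2 * t) ^ 18 * (s.card : ℝ) ^ 5 := by ring
        _ ≤ _ := this
        _ = _ := by
          rw [hA]
          field_simp) hq0 Finset.univ
  have h₂ := h₁.trans (mul_le_mul_of_nonneg_left (sum_range_le_weakTypeConst hq _)
    (by positivity))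
  calc _ = (∑ x, h x ^ q) ^ (1 / q) := by
        congr 1
        refine Finset.sum_congr rfl fun x _ => ?_
        rw [hh, Real.mul_rpow (by positivity) (by positivity)]
    _ ≤ ((2816 * A ^ 9) ^ (q / 18) * weakTypeConst q) ^ (1 / q) :=
        Real.rpow_le_rpow (Finset.sum_nonneg fun x _ => by positivity) h₂ (by positivity)
    _ = _ := by
        rw [Real.mul_rpow (by positivity) hZ, ← Real.rpow_mul (by positivity),
          show q / 18 * (1 / q) = 1 / 18 by field_simp,
          Real.mul_rpow (by norm_num) (by positivity), ← Real.rpow_natCast A 9,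
          ← Real.rpow_mul hA0, show ((9 : ℕ) : ℝ) * (1 / 18) = 1 / 2 by norm_num]
        ring

end WeakType

/-! ### Translation to `eLpNorm` and to coordinates on the paraboloid. -/

section Norms

/-- The weight c covers both measures: 1 for counting measure, 1/|F|² for surface measure. -/
theorem eLpNorm_smul_count_eq {X : Type*} [Fintype X] [MeasurableSpace X]
    [MeasurableSingletonClass X] (f : X → ℂ) {q : ℝ} (hq : 0 < q) {c : ℝ} (hc : 0 ≤ c) :
    eLpNorm f (ENNReal.ofReal q) (ENNReal.ofReal c • (Measure.count : Measure X)) =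
      ENNReal.ofReal ((c * ∑ x, ‖f x‖ ^ q) ^ (1 / q)) := by
  rw [eLpNorm_eq_lintegral_rpow_enorm_toReal (by simpa using hq) ENNReal.ofReal_ne_top,
    lintegral_smul_measure, lintegral_count, tsum_fintype, ENNReal.toReal_ofReal hq.le,
    ← ENNReal.ofReal_rpow_of_nonneg (by positivity) (by positivity), ENNReal.ofReal_mul hc,
    ENNReal.ofReal_sum_of_nonneg fun _ _ => by positivity]
  congr 2
  refine Finset.sum_congr rfl fun x _ => ?_
  rw [← ENNReal.ofReal_rpow_of_nonneg (norm_nonneg _) hq.le, ofReal_norm]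

end Norms

section Coordinates

variable {F : Type*} [Field F] [Fintype F]

theorem vec_mem_paraboloid (ξ : F × F) : ![ξ.1, ξ.2, planeDot ξ ξ] ∈ paraboloid F 2 := by
  classical
  simp only [paraboloid, Finset.mem_image, Finset.mem_univ, true_and]
  refine ⟨![ξ.1, ξ.2], ?_⟩
  ext i
  fin_cases i <;> simp [Fin.snoc, planeDot, dotProduct, Fin.sum_univ_two]

/-- The parametrisation of the paraboloid by the plane. -/
noncomputable def paraboloidEquiv : F × F ≃ paraboloid F 2 :=
  Equiv.ofBijective (fun ξ => ⟨![ξ.1, ξ.2, planeDot ξ ξ], vec_mem_paraboloid ξ⟩) <| by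
    classical
    constructor
    · intro ξ η h
      have h' := congrArg Subtype.val h
      have h0 := congrFun h' 0
      have h1 := congrFun h' 1
      exact Prod.ext h0 h1
    · rintro ⟨v, hv⟩
      simp only [paraboloid, Finset.mem_image, Finset.mem_univ, true_and] at hv
      obtain ⟨w, rfl⟩ := hv
      refine ⟨(w 0, w 1), Subtype.ext ?_⟩
      ext i
      fin_cases i <;> simp [Fin.snoc, planeDot, dotProduct, Fin.sum_univ_two]

theorem card_paraboloid : (paraboloid F 2).card = Fintype.card F ^ 2 := by
  rw [← Fintype.card_coe, ← Fintype.card_congr paraboloidEquiv, Fintype.card_prod, sq]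

/-- Coordinates on the frequency space. -/
def spaceEquiv (F : Type*) : (F × F) × F ≃ (Fin 3 → F) where
  toFun x := ![x.1.1, x.1.2, x.2]
  invFun v := ((v 0, v 1), v 2)
  left_inv _ := rfl
  right_inv v := by ext i; fin_cases i <;> rfl

theorem extension_paraboloid_eq (e : AddChar F Circle) (g : paraboloid F 2 → ℂ)
    (x : (F × F) × F) :
    extension e (paraboloid F 2) g (spaceEquiv F x) = ((Fintype.card F : ℂ) ^ 2)⁻¹ *
      ∑ ξ, g (paraboloidEquiv ξ) * Circle.coeHom.compAddChar e (paraboloidPhase x ξ) := by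
  rw [extension, card_paraboloid, ← Equiv.sum_comp paraboloidEquiv]
  push_cast
  congr 1
  refine Finset.sum_congr rfl fun ξ _ => ?_
  have : spaceEquiv F x ⬝ᵥ (paraboloidEquiv ξ : Fin 3 → F) = paraboloidPhase x ξ := by
    simp only [dotProduct, Fin.sum_univ_three]
    rfl
  rw [this]
  rfl

end Coordinates

theorem theorem6p1 (ε : ℝ) (hε : 0 < ε) :
    ∃ C : ℝ≥0, ∀ (F : Type*) [Field F] [Fintype F] (e : AddChar F Circle),
      e ≠ 1 → ¬ IsSquare (-1 : F) →
        restrictionConst e (paraboloid F 2) 2 (ENNReal.ofReal (18 / 5 + ε)) ≤ (C : ℝ≥0∞) := by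
  set q := 18 / 5 + ε with hq
  have hq' : 18 / 5 < q := by linarith
  have hq0 : 0 < q := by linarith
  have hZ : 0 ≤ weakTypeConst q := tsum_nonneg fun _ => by positivity
  refine ⟨(2816 ^ (1 / 18 : ℝ) * weakTypeConst q ^ (1 / q)).toNNReal, ?_⟩
  intro F _ _ e he hF
  -- It suffices that the constant is admissible for every g, since the best constant is an infimum.
  refine sInf_le fun g => ?_
  set ψ : AddChar F ℂ := Circle.coeHom.compAddChar e with hψ'
  have hψ : ψ ≠ 1 := by
    intro h
    apply he
    ext x
    exact DFunLike.congr_fun h x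
  have h := sum_extension_rpow_le hF hψ (fun ξ => g (paraboloidEquiv ξ)) hq'
  have h₁ := @eLpNorm_smul_count_eq (Fin 3 → F) _ ⊤ (@MeasurableSingletonClass.mk _ ⊤ fun _ => trivial)
    (extension e (paraboloid F 2) g) q hq0 1 zero_le_one
  have h₂ := @eLpNorm_smul_count_eq (paraboloid F 2) _ ⊤
    (@MeasurableSingletonClass.mk _ ⊤ fun _ => trivial) g 2 two_pos
    ((Fintype.card F : ℝ) ^ 2)⁻¹ (by positivity)
  rw [ENNReal.ofReal_one, one_smul, one_mul, ← Equiv.sum_comp (spaceEquiv F)] at h₁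
  have hc : ENNReal.ofReal ((Fintype.card F : ℝ) ^ 2)⁻¹ = ((paraboloid F 2).card : ℝ≥0∞)⁻¹ := by
    have hQ : (0 : ℝ) < Fintype.card F := by exact_mod_cast Fintype.card_pos
    rw [card_paraboloid, ENNReal.ofReal_inv_of_pos (by positivity), ← Nat.cast_pow,
      ENNReal.ofReal_natCast]
  rw [hc, show ENNReal.ofReal 2 = 2 by norm_num, ← Equiv.sum_comp paraboloidEquiv] at h₂
  simp only [extension_paraboloid_eq] at h₁
  rw [countingMeasure, surfaceMeasure, h₁, h₂]
  change _ ≤ ENNReal.ofReal _ * _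
  rw [← ENNReal.ofReal_mul (by positivity)]
  refine ENNReal.ofReal_le_ofReal ?_
  refine le_trans (le_of_eq ?_) (h.trans (le_of_eq ?_))
  · congr 1
    refine Finset.sum_congr rfl fun x _ => ?_
    rw [norm_mul, Real.mul_rpow (norm_nonneg _) (norm_nonneg _)]
    simp [ψ]
  · congr 4
    exact funext fun ξ => (Real.rpow_two _).symm
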